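/- **Theorem (Dedekind II).** Let $(A,\mathfrak m)$ be a Noetherian local integrally closed domain with fraction field $K$. Let $f\in K[x]$ be an irreducible polynomial with Galois splitting field $\overline L/K$, all of whose roots are integral over $A$ (for example, $f$ monic with coefficients in $A$), and let $\overline B$ be the integral closure of $A$ in $\overline L$. Let $L_C\supseteq\overline L$ be a field that is a finite Galois extension of $K$, let $C\supseteq\overline B$ be the integral closure of $A$ in $L_C$, let $\mathfrak m_C$ be a prime ideal of $C$ lying over $\mathfrak m$, and put $\overline{\mathfrak m}=\mathfrak m_C\cap\overline B$. Let $$D_{\mathfrak m_C}=\{\sigma\in\mathrm{Gal}(L_C/K):\sigma(\mathfrak m_C)=\mathfrak m_C\},\qquad D_{\overline{\mathfrak m}}=\{\sigma\in\mathrm{Gal}(\overline L/K):\sigma(\overline{\mathfrak m})=\overline{\mathfrak m}\}$$ be the decomposition groups. Let $C_{\mathfrak m_C}$ denote either the localization of $C$ at $\mathfrak m_C$ or the completion of this localization with respect to its maximal ideal, with the induced action of $D_{\mathfrak m_C}$. Let $V$ be the set of roots of $f$ in $C$ and let $$i_1\colon D_{\overline{\mathfrak m}}\to\prod_i\mathrm{Aut}(V_i)$$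 be the factorization of the action of $D_{\overline{\mathfrak m}}$ on $V$ into its orbits $V_i$, where $\mathrm{Aut}$ denotes the group of permutations of a set. Then restriction of automorphisms to $\overline L$ gives a surjective homomorphism $D_{\mathfrak m_C}\to D_{\overline{\mathfrak m}}$. Moreover, let $I\subseteq C_{\mathfrak m_C}$ be an ideal with $\sigma(I)=I$ for all $\sigma\in D_{\mathfrak m_C}$ that is separating for the roots of $f$, i.e. the quotient map $C_{\mathfrak m_C}\to C_{\mathfrak m_C}/I$ is injective on the image of $V$ in $C_{\mathfrak m_C}$, and let $\overline V$ be the image of $V$ in $C_{\mathfrak m_C}/I$. Then: 1. There is an action of $D_{\overline{\mathfrak m}}$ on $\overline V$ that is induced by the action of $D_{\mathfrak m_C}$ on $C_{\mathfrak m_C}/I$: for every $\sigma\in D_{\mathfrak m_C}$, the restriction $\sigma|_{\overline L}$ acts on $\overline V$ as $\sigma$ does. 2. The factorization of this action into its orbits $\overline V_i$ is an injective homomorphism $$i_2\colon D_{\overline{\mathfrak m}}\to\prod_i\mathrm{Aut}(\overline V_i).$$ 3. Reduction modulo $I$ induces a bijection between the set of orbits of $D_{\overline{\mathfrak m}}$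 on $V$ and the set of its orbits on $\overline V$, together with bijections $V_i\simeq\overline V_i$ of corresponding orbits, such that the induced isomorphism $j\colon\prod_i\mathrm{Aut}(V_i)\simeq\prod_i\mathrm{Aut}(\overline V_i)$ satisfies $i_2=j\circ i_1$. -/

import Mathlib

open scoped Pointwise Polynomial

namespace GaloisApproximation

noncomputable section

section GroupActions

/-- For a group `G` acting on a set `X` with orbits `X_i`, the factorization
`G → ∏ i, Aut (X_i)` of the action into its orbits. -/
def orbitFactorization (G X : Type*) [Group G] [MulAction G X] :
    G →* ∀ i : MulAction.orbitRel.Quotient G X, Equiv.Perm i.orbit :=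
  MonoidHom.pi fun i => MulAction.toPermHom G i.orbit

/-- The isomorphism `∏ i, Aut (X_i) ≃ ∏ k, Aut (Y_k)` induced by a bijection `e` of the index sets
and bijections `b i : X_i ≃ Y_(e i)`; its component at `e i` is `τ ↦ b i ∘ τ_i ∘ (b i)⁻¹`. -/
def permPiCongr {ι κ : Type*} {X : ι → Type*} {Y : κ → Type*} (e : ι ≃ κ)
    (b : ∀ i, X i ≃ Y (e i)) : (∀ i, Equiv.Perm (X i)) ≃* (∀ k, Equiv.Perm (Y k)) :=
  { Equiv.piCongr e (fun i => (b i).permCongr) with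
    map_mul' := by
      intro x y
      funext k
      obtain ⟨i, rfl⟩ := e.surjective k
      simp only [Equiv.toFun_as_coe, Pi.mul_apply, Equiv.piCongr_apply_apply,
        Equiv.permCongr_mul] }

lemma permPiCongr_apply {ι κ : Type*} {X : ι → Type*} {Y : κ → Type*} (e : ι ≃ κ)
    (b : ∀ i, X i ≃ Y (e i)) (x : ∀ i, Equiv.Perm (X i)) (i : ι) :
    permPiCongr e b x (e i) = (b i).permCongr (x i) :=
  Equiv.piCongr_apply_apply (W := fun i => Equiv.Perm (X i)) (Z := fun k => Equiv.Perm (Y k)) e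
    (fun i => (b i).permCongr) x i

/-- Let `G` act on `X` with orbits `X_i` and on `Y` with orbits `Y_k`, and let `r : X → Y` be a map.
The predicate says that `r` restricts to bijections `b i : X_i ≃ Y_(e i)` for a bijection `e` between
the sets of orbits, and that the induced isomorphism `j : ∏ i, Aut (X_i) ≃ ∏ k, Aut (Y_k)`
satisfies `i₂ = j ∘ i₁` for the factorizations `i₁ : G → ∏ i, Aut (X_i)` and
`i₂ : G → ∏ k, Aut (Y_k)` of the two actions into their orbits. -/
def MatchesOrbits (G : Type*) {X Y : Type*} [Group G] [MulAction G X] [MulAction G Y]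
    (r : X → Y) : Prop :=
  ∃ (e : MulAction.orbitRel.Quotient G X ≃ MulAction.orbitRel.Quotient G Y)
    (b : ∀ i : MulAction.orbitRel.Quotient G X, i.orbit ≃ (e i).orbit),
    (∀ (i : MulAction.orbitRel.Quotient G X) (v : i.orbit), (b i v : Y) = r v) ∧
    orbitFactorization G Y = (permPiCongr e b).toMonoidHom.comp (orbitFactorization G X)

/-- An ideal `I` is separating for a subset `T` of a ring if `R → R ⧸ I` is injective on `T`. -/
def IsSeparating {R : Type*} [CommRing R] (I : Ideal R) (T : Set R) : Prop :=
  Set.InjOn (Ideal.Quotient.mk I) T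

/-- An ideal `I` is invariant under a group `G` of automorphisms if `σ(I) = I` for all `σ`. -/
def IsInvariantIdeal (G : Type*) {R : Type*} [Group G] [CommRing R] [MulSemiringAction G R]
    (I : Ideal R) : Prop :=
  ∀ σ : G, σ • I = I

/-- The ring homomorphism `R ⧸ I → R ⧸ I` induced by `σ : R → R`, for an invariant ideal `I`. -/
def quotientAction {G R : Type*} [Group G] [CommRing R] [MulSemiringAction G R]
    {I : Ideal R} (hI : IsInvariantIdeal G I) (σ : G) : R ⧸ I →+* R ⧸ I :=
  Ideal.quotientMap I (MulSemiringAction.toRingHom G R σ) (by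
    intro x hx
    have h := Ideal.smul_mem_pointwise_smul σ x I hx
    rw [hI σ] at h
    exact h)

end GroupActions

section LocalActions

variable {G S : Type*} [Group G] [CommRing S] [MulSemiringAction G S]

lemma eq_comap_of_mem_stabilizer (P : Ideal S) (σ : MulAction.stabilizer G P) :
    P = P.comap (MulSemiringAction.toRingHom G S (σ : G)) := by
  have h : (σ : G) • P = P := σ.2
  ext x
  rw [Ideal.mem_comap, MulSemiringAction.toRingHom_apply,
    ← Ideal.smul_mem_pointwise_smul_iff (a := (σ : G)), h]

/-- The decomposition group of a prime `P` acts on the localization at `P`,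
by `σ (a / s) = σ a / σ s`. -/
instance localizationAction (P : Ideal S) [P.IsPrime] :
    MulSemiringAction (MulAction.stabilizer G P) (Localization.AtPrime P) where
  smul σ := Localization.localRingHom P P (MulSemiringAction.toRingHom G S (σ : G))
    (eq_comap_of_mem_stabilizer P σ)
  one_smul x := by
    change Localization.localRingHom P P _ _ x = x
    rw [Localization.localRingHom_unique P P _ (eq_comap_of_mem_stabilizer P 1)
      (j := RingHom.id _) (fun r => by simp)]
    rfl
  mul_smul σ τ x := by
    change Localization.localRingHom P P _ _ x =
      Localization.localRingHom P P _ (eq_comap_of_mem_stabilizer P σ)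
        (Localization.localRingHom P P _ (eq_comap_of_mem_stabilizer P τ) x)
    rw [Localization.localRingHom_unique P P _ (eq_comap_of_mem_stabilizer P (σ * τ))
      (j := (Localization.localRingHom P P _ (eq_comap_of_mem_stabilizer P σ)).comp
        (Localization.localRingHom P P _ (eq_comap_of_mem_stabilizer P τ)))
      (fun r => by simp [Localization.localRingHom_to_map, mul_smul])]
    rfl
  smul_zero σ := map_zero (Localization.localRingHom P P _ _)
  smul_add σ := map_add (Localization.localRingHom P P _ _)
  smul_one σ := map_one (Localization.localRingHom P P _ _)
  smul_mul σ := map_mul (Localization.localRingHom P P _ _)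

lemma localizationAction_algebraMap (P : Ideal S) [P.IsPrime] (σ : MulAction.stabilizer G P)
    (x : S) : σ • algebraMap S (Localization.AtPrime P) x =
      algebraMap S (Localization.AtPrime P) ((σ : G) • x) :=
  Localization.localRingHom_to_map P P _ (eq_comap_of_mem_stabilizer P σ) x

variable {R : Type*} [CommRing R] [IsLocalRing R] [MulSemiringAction G R]

lemma maximalIdeal_pow_le_comap (σ : G) (n : ℕ) :
    IsLocalRing.maximalIdeal R ^ n ≤
      (IsLocalRing.maximalIdeal R ^ n).comap (MulSemiringAction.toRingHom G R σ) := by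
  have h : (IsLocalRing.maximalIdeal R).map (MulSemiringAction.toRingHom G R σ) ≤
      IsLocalRing.maximalIdeal R := by
    rw [Ideal.map_le_iff_le_comap]
    intro x hx
    rw [Ideal.mem_comap, MulSemiringAction.toRingHom_apply, IsLocalRing.mem_maximalIdeal,
      mem_nonunits_iff]
    intro hu
    apply (IsLocalRing.mem_maximalIdeal x).mp hx
    have := hu.map (MulSemiringAction.toRingHom G R σ⁻¹)
    simpa using this
  rw [← Ideal.map_le_iff_le_comap, Ideal.map_pow]
  exact Ideal.pow_right_mono h n

/-- The map from the completion of a local ring `R` with maximal ideal `m` to `R ⧸ m ^ n` induced by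
an automorphism `σ` of `R`. -/
def completionMapModPow (σ : G) (n : ℕ) :
    AdicCompletion (IsLocalRing.maximalIdeal R) R →+* R ⧸ IsLocalRing.maximalIdeal R ^ n :=
  (Ideal.quotientMap (IsLocalRing.maximalIdeal R ^ n)
    (MulSemiringAction.toRingHom G R σ) (maximalIdeal_pow_le_comap σ n)).comp
      (AdicCompletion.evalₐ (IsLocalRing.maximalIdeal R) n).toRingHom

lemma completionMapModPow_mk (σ : G) (n : ℕ)
    (a : AdicCompletion.AdicCauchySequence (IsLocalRing.maximalIdeal R) R) :
    completionMapModPow σ n (AdicCompletion.mk (IsLocalRing.maximalIdeal R) R a) =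
      Ideal.Quotient.mk _ (σ • a n) := by
  change Ideal.quotientMap (IsLocalRing.maximalIdeal R ^ n)
    (MulSemiringAction.toRingHom G R σ) (maximalIdeal_pow_le_comap σ n)
      (AdicCompletion.evalₐ (IsLocalRing.maximalIdeal R) n
        (AdicCompletion.mk (IsLocalRing.maximalIdeal R) R a)) = _
  rw [AdicCompletion.evalₐ_mk, Ideal.quotientMap_mk]
  rfl

lemma completionMapModPow_compatible (σ : G) {m n : ℕ} (hle : m ≤ n) :
    (Ideal.Quotient.factorPow (IsLocalRing.maximalIdeal R) hle).comp
      (completionMapModPow (R := R) σ n) = completionMapModPow σ m := by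
  ext x
  obtain ⟨a, rfl⟩ := AdicCompletion.mk_surjective _ _ x
  rw [RingHom.comp_apply, completionMapModPow_mk, completionMapModPow_mk]
  exact congrArg (Ideal.quotientMap (IsLocalRing.maximalIdeal R ^ m)
    (MulSemiringAction.toRingHom G R σ) (maximalIdeal_pow_le_comap σ m))
    (AdicCompletion.Ideal.mk_eq_mk (I := IsLocalRing.maximalIdeal R) hle a)

/-- The endomorphism of the completion of a local ring induced by an automorphism `σ` of the ring;
modulo the `n`-th power of the maximal ideal it is the map induced by `σ`. -/
def completionMap (σ : G) :
    AdicCompletion (IsLocalRing.maximalIdeal R) R →+*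
      AdicCompletion (IsLocalRing.maximalIdeal R) R :=
  AdicCompletion.liftRingHom (IsLocalRing.maximalIdeal R) (completionMapModPow σ)
    (completionMapModPow_compatible σ)

lemma evalₐ_completionMap (σ : G) (n : ℕ)
    (x : AdicCompletion (IsLocalRing.maximalIdeal R) R) :
    AdicCompletion.evalₐ (IsLocalRing.maximalIdeal R) n (completionMap σ x) =
      Ideal.quotientMap (IsLocalRing.maximalIdeal R ^ n)
        (MulSemiringAction.toRingHom G R σ) (maximalIdeal_pow_le_comap σ n)
        (AdicCompletion.evalₐ (IsLocalRing.maximalIdeal R) n x) :=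
  AdicCompletion.evalₐ_liftRingHom (IsLocalRing.maximalIdeal R) (completionMapModPow σ)
    (completionMapModPow_compatible σ) n x

/-- The induced action on the completion of a local ring. -/
instance completionAction :
    MulSemiringAction G (AdicCompletion (IsLocalRing.maximalIdeal R) R) where
  smul σ := completionMap σ
  one_smul x := by
    change completionMap 1 x = x
    refine AdicCompletion.ext_evalₐ fun n => ?_
    obtain ⟨a, rfl⟩ := AdicCompletion.mk_surjective _ _ x
    rw [evalₐ_completionMap, AdicCompletion.evalₐ_mk, Ideal.quotientMap_mk,
      MulSemiringAction.toRingHom_apply, one_smul]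
  mul_smul σ τ x := by
    change completionMap (σ * τ) x = completionMap σ (completionMap τ x)
    refine AdicCompletion.ext_evalₐ fun n => ?_
    obtain ⟨a, rfl⟩ := AdicCompletion.mk_surjective _ _ x
    rw [evalₐ_completionMap, evalₐ_completionMap, evalₐ_completionMap, AdicCompletion.evalₐ_mk,
      Ideal.quotientMap_mk, Ideal.quotientMap_mk, Ideal.quotientMap_mk]
    simp only [MulSemiringAction.toRingHom_apply, mul_smul]
  smul_zero σ := map_zero (completionMap σ)
  smul_add σ := map_add (completionMap σ)
  smul_one σ := map_one (completionMap σ)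
  smul_mul σ := map_mul (completionMap σ)

lemma completionAction_algebraMap (σ : G) (x : R) :
    σ • algebraMap R (AdicCompletion (IsLocalRing.maximalIdeal R) R) x =
      algebraMap R (AdicCompletion (IsLocalRing.maximalIdeal R) R) (σ • x) := by
  change completionMap σ _ = _
  refine AdicCompletion.ext_evalₐ fun n => ?_
  rw [evalₐ_completionMap, AlgHom.commutes, AlgHom.commutes]
  rfl

end LocalActions

section Roots

variable (A : Type*) {K : Type*} [CommRing A] [Field K] [Algebra A K]

/-- The set of roots of `f ∈ K[x]` in the integral closure of `A` in an extension `L` of `K`. -/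
def integralRoots (f : K[X]) (L : Type*) [Field L] [Algebra K L] [Algebra A L] :
    Set (integralClosure A L) :=
  {x | Polynomial.aeval (x : L) f = 0}

/-- `Gal(L/K)` acts on the roots of `f` in the integral closure of `A` in `L`. -/
@[reducible]
def galoisActionOnRoots (f : K[X]) (L : Type*) [Field L] [Algebra K L] [Algebra A L]
    [IsScalarTower A K L] : MulAction Gal(L/K) (integralRoots A f L) where
  smul σ x := ⟨σ • x.1, by
    have hx : Polynomial.aeval ((x.1 : integralClosure A L) : L) f = 0 := x.2
    change Polynomial.aeval (σ ((x.1 : integralClosure A L) : L)) f = 0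
    rw [Polynomial.aeval_algHom_apply σ, hx, map_zero]⟩
  one_smul x := Subtype.ext (one_smul _ x.1)
  mul_smul σ τ x := Subtype.ext (mul_smul σ τ x.1)

variable (K) (M N : Type*) [Field M] [Field N] [Algebra K M] [Algebra K N] [Algebra M N]
  [Algebra A M] [Algebra A N] [IsScalarTower A K M] [IsScalarTower K M N] [IsScalarTower A M N]

/-- For fields `M ⊆ N`, the inclusion of the integral closure of `A` in `M` into the integral
closure of `A` in `N`. -/
def inclusion : integralClosure A M →ₐ[A] integralClosure A N :=
  (IsScalarTower.toAlgHom A M N).mapIntegralClosure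

variable {K}

/-- If `f` splits in `M ⊆ N`, the roots of `f` in the integral closure of `A` in `M` are (through
the inclusion) the roots of `f` in the integral closure of `A` in `N`. -/
def rootsEquiv (f : K[X]) [Fact (Irreducible f)] [f.IsSplittingField K M] :
    integralRoots A f M ≃ integralRoots A f N :=
  Equiv.ofBijective
    (fun x => ⟨inclusion A M N x.1, by
      have hx : Polynomial.aeval ((x.1 : integralClosure A M) : M) f = 0 := x.2
      change Polynomial.aeval (algebraMap M N ((x.1 : integralClosure A M) : M)) f = 0
      rw [Polynomial.aeval_algebraMap_apply, hx, map_zero]⟩)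
    (by
      have hinj : Function.Injective (algebraMap M N) := (algebraMap M N).injective
      constructor
      · intro x y h
        have h' : algebraMap M N ((x.1 : integralClosure A M) : M) =
            algebraMap M N ((y.1 : integralClosure A M) : M) :=
          congrArg (fun z : integralRoots A f N => ((z.1 : integralClosure A N) : N)) h
        exact Subtype.ext (Subtype.ext (hinj h'))
      · rintro ⟨⟨y, hy⟩, hroot⟩
        have hroot' : Polynomial.aeval y f = 0 := hroot
        have hf0 : f.map (algebraMap K M) ≠ 0 :=
          Polynomial.map_ne_zero (Fact.out : Irreducible f).ne_zero
        have hsp := Polynomial.IsSplittingField.splits M f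
        have hy' : y ∈ (algebraMap M N).range := by
          refine hsp.mem_range_of_isRoot hf0 ?_
          rw [Polynomial.map_map, ← IsScalarTower.algebraMap_eq K M N, Polynomial.IsRoot.def,
            Polynomial.eval_map, ← Polynomial.aeval_def, hroot']
        obtain ⟨z, rfl⟩ := hy'
        have hz : IsIntegral A z := (isIntegral_algebraMap_iff hinj).mp hy
        refine ⟨⟨⟨z, hz⟩, hinj ?_⟩, rfl⟩
        rw [← Polynomial.aeval_algebraMap_apply, map_zero]
        exact hroot')

/-- For `M ⊆ N` with `M` the splitting field of `f`, the action of `Gal(M/K)` on the roots of `f`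
in the integral closure of `A` in `N`; these roots all lie in `M`, and `Gal(M/K)` acts on them
as on elements of `M`. -/
instance galoisActionOnRootsOfSplits (f : K[X]) [Fact (Irreducible f)] [f.IsSplittingField K M] :
    MulAction Gal(M/K) (integralRoots A f N) :=
  letI := galoisActionOnRoots A f M
  (rootsEquiv A M N f).symm.mulAction Gal(M/K)

lemma galoisActionOnRootsOfSplits_rootsEquiv (f : K[X]) [Fact (Irreducible f)]
    [f.IsSplittingField K M] (σ : Gal(M/K)) (x : integralRoots A f M) :
    σ • rootsEquiv A M N f x =
      rootsEquiv A M N f ((galoisActionOnRoots A f M).smul σ x) := by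
  change rootsEquiv A M N f ((galoisActionOnRoots A f M).smul σ
    ((rootsEquiv A M N f).symm (rootsEquiv A M N f x))) = _
  rw [Equiv.symm_apply_apply]

end Roots

section Decomposition

variable (A K M N : Type*) [CommRing A] [Field K] [Field M] [Field N] [Algebra A K]
  [Algebra K M] [Algebra K N] [Algebra M N] [Algebra A M] [Algebra A N]
  [IsScalarTower A K M] [IsScalarTower A K N] [IsScalarTower K M N] [IsScalarTower A M N]

/-- The decomposition group of an ideal `P` of the integral closure of `A` in `L`: the subgroup of
`Gal(L/K)` of all `σ` with `σ(P) = P`. -/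
abbrev decompositionGroup (L : Type*) [Field L] [Algebra K L] [Algebra A L] [IsScalarTower A K L]
    (P : Ideal (integralClosure A L)) : Subgroup Gal(L/K) :=
  MulAction.stabilizer Gal(L/K) P

/-- The restriction of an ideal along the inclusion of integral closures of `A` in `M ⊆ N`. -/
def idealBelow (P : Ideal (integralClosure A N)) : Ideal (integralClosure A M) :=
  P.comap (inclusion A M N)

variable {A N} in
lemma restrictNormalHom_mem [Normal K M] (P : Ideal (integralClosure A N)) (σ : Gal(N/K))
    (hσ : σ ∈ decompositionGroup A K N P) :
    AlgEquiv.restrictNormalHom M σ ∈ decompositionGroup A K M (idealBelow A M N P) := by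
  have hcomm (x : integralClosure A M) :
      inclusion A M N (AlgEquiv.restrictNormalHom M σ • x) = σ • inclusion A M N x :=
    Subtype.ext (AlgEquiv.restrictNormal_commutes σ M (x : M))
  have hP : σ • P = P := hσ
  have key (x : integralClosure A M) :
      AlgEquiv.restrictNormalHom M σ • x ∈ idealBelow A M N P ↔ x ∈ idealBelow A M N P := by
    rw [idealBelow, Ideal.mem_comap, Ideal.mem_comap, hcomm,
      ← Ideal.smul_mem_pointwise_smul_iff (a := σ) (x := inclusion A M N x), hP]
  rw [MulAction.mem_stabilizer_iff]
  ext x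
  rw [Ideal.mem_pointwise_smul_iff_inv_smul_mem, ← key, smul_inv_smul]

/-- For `M ⊆ N` normal over `K`, restriction of automorphisms to `M`, as a homomorphism from the
decomposition group of `P` to the decomposition group of the ideal below `P`. -/
def restrictDecomposition [Normal K M] (P : Ideal (integralClosure A N)) :
    decompositionGroup A K N P →* decompositionGroup A K M (idealBelow A M N P) :=
  ((AlgEquiv.restrictNormalHom M).comp (decompositionGroup A K N P).subtype).codRestrict _
    (fun σ => restrictNormalHom_mem K M P σ.1 σ.2)

variable {K}

/-- The image in `R ⧸ I` of the set of roots of `f` in the integral closure of `A` in `N`. -/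
def rootImages (f : K[X]) {R : Type*} [CommRing R] [Algebra (integralClosure A N) R]
    (I : Ideal R) : Set (R ⧸ I) :=
  (fun v => Ideal.Quotient.mk I (algebraMap (integralClosure A N) R v)) '' integralRoots A f N

/-- The reduction map from the set of roots of `f` in the integral closure of `A` in `N` to its image
in `R ⧸ I`. -/
def reduceRoot (f : K[X]) {R : Type*} [CommRing R] [Algebra (integralClosure A N) R]
    (I : Ideal R) (v : integralRoots A f N) : rootImages A N f I :=
  ⟨Ideal.Quotient.mk I (algebraMap (integralClosure A N) R v.1), v.1, v.2, rfl⟩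

/-- Let `C` be the integral closure of `A` in `N`, let `V` be the set of roots of `f` in `C`, let
`R` be a `C`-algebra with an action of the decomposition group `D_P` of an ideal `P` of `C`, and let
`D` be the decomposition group of the ideal below `P` in the integral closure of `A` in the
splitting field `M ⊆ N` of `f`.

The predicate says that for every `D_P`-invariant ideal `I` of `R` that is separating for the roots
of `f`, there is an action of `D` on the image `V'` of `V` in `R ⧸ I` such that the following hold.
* It is induced by the action of `D_P` on `R ⧸ I`: for `σ` in `D_P`, the restriction of `σ` in `D`
  acts on `V'` as `σ` does.
* The factorization `D → ∏ k, Aut (V'_k)` of this action into orbits is injective.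
* Reduction modulo `I` gives bijections of the orbits `V_i` of `D` on `V` with the orbits `V'_i` of
  `D` on `V'` that identify the factorizations of the two actions into orbits. -/
def OrbitsSeenModuloIdeals (f : K[X]) [Fact (Irreducible f)] [f.IsSplittingField K M] [Normal K M]
    (P : Ideal (integralClosure A N)) (R : Type*) [CommRing R] [Algebra (integralClosure A N) R]
    [MulSemiringAction (decompositionGroup A K N P) R] : Prop :=
  ∀ (I : Ideal R) (hI : IsInvariantIdeal (decompositionGroup A K N P) I),
    IsSeparating I (algebraMap (integralClosure A N) R '' integralRoots A f N) →
    ∃ _action : MulAction (decompositionGroup A K M (idealBelow A M N P)) (rootImages A N f I),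
      (∀ (σ : decompositionGroup A K N P) (x : rootImages A N f I),
        (restrictDecomposition A K M N P σ • x).1 = quotientAction hI σ x.1) ∧
      Function.Injective (orbitFactorization (decompositionGroup A K M (idealBelow A M N P))
        (rootImages A N f I)) ∧
      MatchesOrbits (decompositionGroup A K M (idealBelow A M N P)) (reduceRoot A N f I)

end Decomposition

end

end GaloisApproximation

/-! Surjectivity is the classical lifting argument. An arbitrary extension σ of an element of the
lower decomposition group to `N` moves `P` to a prime with the same restriction to the integral
closure in `M`. The group Gal(N/M) permutes the primes over a given one transitively, so some ρ in
it brings σP back to `P`, and ρσ has the same restriction to `M` as σ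
(`restrictDecomposition_surjective`).

The orbit statements rest on one observation: when the `C`-algebra map to `R` is injective and `I`
is separating, reduction is a bijection from the roots to their images (`reduceRoot_bijective`). The
action on the images is obtained by transport along it, so reduction is equivariant by construction
and matches orbits. The transported action agrees with the one on `R ⧸ I` because the map to `R` is
equivariant. It is faithful because the roots, being integral over `A`, all lie in `C` and generate
the splitting field. Localization and completion differ only in why `C` embeds equivariantly. -/

namespace GaloisApproximation

/-! ### Orbits under equivariant bijections and faithful actions. -/

section GroupActions

variable {G X Y : Type*} [Group G] [MulAction G X] [MulAction G Y]

/-- An equivariant bijection matches the orbits of the two actions. -/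
lemma matchesOrbits_of_equiv (φ : X ≃ Y) (hφ : ∀ (g : G) (x : X), φ (g • x) = g • φ x) :
    MatchesOrbits G φ := by
  have hrel (x y : X) : MulAction.orbitRel G X x y ↔ MulAction.orbitRel G Y (φ x) (φ y) := by
    simp only [MulAction.orbitRel_apply, MulAction.mem_orbit_iff, ← hφ, φ.injective.eq_iff]
  let e : MulAction.orbitRel.Quotient G X ≃ MulAction.orbitRel.Quotient G Y :=
    Quotient.congr φ hrel
  have hmem (i : MulAction.orbitRel.Quotient G X) (x : X) : x ∈ i.orbit ↔ φ x ∈ (e i).orbit := by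
    rw [MulAction.orbitRel.Quotient.mem_orbit, MulAction.orbitRel.Quotient.mem_orbit]
    -- By construction `e` sends the class of `x` to the class of `φ x`.
    exact (e.injective.eq_iff (a := Quotient.mk'' x) (b := i)).symm
  let b (i : MulAction.orbitRel.Quotient G X) : i.orbit ≃ (e i).orbit := φ.subtypeEquiv (hmem i)
  refine ⟨e, b, fun i v => rfl, ?_⟩
  ext1 g
  funext k
  -- Writing the index as `e i` avoids a transport between the dependent factors.
  obtain ⟨i, rfl⟩ := e.surjective k
  change _ = permPiCongr (X := fun i : MulAction.orbitRel.Quotient G X => i.orbit)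
    (Y := fun k : MulAction.orbitRel.Quotient G Y => k.orbit) e b (orbitFactorization G X g) (e i)
  rw [permPiCongr_apply]
  ext y
  obtain ⟨x, rfl⟩ := (b i).surjective y
  rw [Equiv.permCongr_apply, Equiv.symm_apply_apply]
  exact (hφ g x).symm

/-- The factorization of a faithful action into its orbits is injective. -/
lemma orbitFactorization_injective [FaithfulSMul G X] :
    Function.Injective (orbitFactorization G X) := by
  intro g h hgh
  refine FaithfulSMul.eq_of_smul_eq_smul (α := X) fun x => ?_
  let i : MulAction.orbitRel.Quotient G X := Quotient.mk'' x
  let v : i.orbit := ⟨x, MulAction.orbitRel.Quotient.mem_orbit.mpr rfl⟩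
  exact congrArg Subtype.val (DFunLike.congr_fun (congrFun hgh i) v)

end GroupActions

/-! ### The Galois action on the roots. -/

section Roots

variable (A : Type*) {K : Type*} [CommRing A] [Field K] [Algebra A K]
  (M N : Type*) [Field M] [Field N] [Algebra K M] [Algebra K N] [Algebra M N]
  [Algebra A M] [Algebra A N] [IsScalarTower A K M] [IsScalarTower K M N] [IsScalarTower A M N]
  (f : K[X]) [Fact (Irreducible f)] [f.IsSplittingField K M]

/-- If the roots of `f` are integral over `A`, the Galois group of its splitting field acts
faithfully on the roots in the integral closure of `A`. -/
lemma galoisActionOnRootsOfSplits_faithful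
    (hf : ∀ x : N, Polynomial.aeval x f = 0 → IsIntegral A x) :
    FaithfulSMul Gal(M/K) (integralRoots A f N) where
  eq_of_smul_eq_smul {σ τ} h := by
    have hroots (x : M) (hx : x ∈ f.rootSet M) : σ x = τ x := by
      have hx0 : Polynomial.aeval x f = 0 := (Polynomial.mem_rootSet.mp hx).2
      have hint : IsIntegral A x := by
        -- Integrality is assumed for roots in `N`; it descends along the injection of `M` into `N`.
        refine (isIntegral_algebraMap_iff (algebraMap M N).injective).mp (hf _ ?_)
        rw [Polynomial.aeval_algebraMap_apply, hx0, map_zero]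
      have hv := h (rootsEquiv A M N f ⟨⟨x, hint⟩, hx0⟩)
      rw [galoisActionOnRootsOfSplits_rootsEquiv, galoisActionOnRootsOfSplits_rootsEquiv] at hv
      exact congrArg (fun z : integralRoots A f M => ((z : integralClosure A M) : M))
        ((rootsEquiv A M N f).injective hv)
    have heq : (σ : M →ₐ[K] M) = τ :=
      AlgHom.ext_of_adjoin_eq_top (Polynomial.IsSplittingField.adjoin_rootSet M f) hroots
    exact AlgEquiv.ext fun x => DFunLike.congr_fun heq x

/-- An automorphism of `N` acts on the roots of `f` through its restriction to the splitting
field. -/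
lemma restrictNormalHom_smul_root [IsScalarTower A K N] [Normal K M] (σ : Gal(N/K))
    (v : integralRoots A f N) :
    ((AlgEquiv.restrictNormalHom M σ • v : integralRoots A f N) : integralClosure A N) =
      σ • (v : integralClosure A N) := by
  obtain ⟨x, rfl⟩ := (rootsEquiv A M N f).surjective v
  rw [galoisActionOnRootsOfSplits_rootsEquiv]
  exact Subtype.ext (AlgEquiv.restrictNormal_commutes σ M ((x : integralClosure A M) : M))

end Roots

lemma reduceRoot_bijective (A : Type*) {K : Type*} (N : Type*) [CommRing A] [Field K] [Field N]
    [Algebra K N] [Algebra A N] (f : K[X]) {R : Type*} [CommRing R] [Algebra (integralClosure A N) R]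
    (hR : Function.Injective (algebraMap (integralClosure A N) R)) {I : Ideal R}
    (hI : IsSeparating I (algebraMap (integralClosure A N) R '' integralRoots A f N)) :
    Function.Bijective (reduceRoot A N f I) := by
  constructor
  · intro v w h
    exact Subtype.ext (hR (hI (Set.mem_image_of_mem _ v.2) (Set.mem_image_of_mem _ w.2)
      (congrArg Subtype.val h)))
  · rintro ⟨_, v, hv, rfl⟩
    exact ⟨⟨v, hv⟩, rfl⟩

/-! ### Lifting decomposition groups and reducing the roots. -/

section Decomposition

variable (A K M N : Type*) [CommRing A] [Field K] [Field M] [Field N] [Algebra A K]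
  [Algebra K M] [Algebra K N] [Algebra M N] [Algebra A M] [Algebra A N]
  [IsScalarTower A K M] [IsScalarTower A K N] [IsScalarTower K M N] [IsScalarTower A M N]

/-- For a finite Galois extension `N` of `M`, primes of the integral closure of `A` in `N` with the
same restriction to the integral closure of `A` in `M` are conjugate under `Gal(N/M)`. -/
lemma exists_smul_eq_of_idealBelow_eq [FiniteDimensional M N] [IsGalois M N]
    (P Q : Ideal (integralClosure A N)) [P.IsPrime] [Q.IsPrime]
    (h : idealBelow A M N P = idealBelow A M N Q) : ∃ τ : Gal(N/M), Q = τ • P := by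
  -- With this algebra structure `idealBelow` is by definition the contraction `Ideal.under`, so the
  -- general transitivity theorem for invariant extensions applies.
  let : Algebra (integralClosure A M) (integralClosure A N) :=
    (inclusion A M N).toRingHom.toAlgebra
  have : SMulCommClass Gal(N/M) (integralClosure A M) (integralClosure A N) :=
    ⟨fun τ b c => Subtype.ext (by
      rw [Algebra.smul_def, Algebra.smul_def]
      change τ (algebraMap M N b * c) = algebraMap M N b * τ c
      rw [map_mul, τ.commutes])⟩
  have : Algebra.IsInvariant (integralClosure A M) (integralClosure A N) Gal(N/M) :=
    ⟨fun c hc => by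
      obtain ⟨y, hy⟩ := (IsGalois.mem_range_algebraMap_iff_fixed (F := M) (c : N)).mpr
        fun τ => congrArg Subtype.val (hc τ)
      have hint : IsIntegral A y :=
        (isIntegral_algebraMap_iff (algebraMap M N).injective).mp (hy ▸ c.2)
      exact ⟨⟨y, hint⟩, Subtype.ext hy⟩⟩
  exact Algebra.IsInvariant.exists_smul_of_under_eq (integralClosure A M) (integralClosure A N)
    Gal(N/M) P Q h

/-- Restriction to `M` maps the decomposition group of a prime onto the decomposition group of the
prime below it. -/
lemma restrictDecomposition_surjective [Normal K M] [FiniteDimensional K N] [IsGalois K N]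
    (P : Ideal (integralClosure A N)) [P.IsPrime] :
    Function.Surjective (restrictDecomposition A K M N P) := by
  have : FiniteDimensional M N := FiniteDimensional.right K M N
  have : IsGalois M N := IsGalois.tower_top_of_isGalois K M N
  rintro ⟨τ, hτ⟩
  -- This lift need not stabilize `P`; only the contraction of `P` is preserved.
  obtain ⟨σ, rfl⟩ := AlgEquiv.restrictNormalHom_surjective (F := K) (K₁ := M) N τ
  have hcomm (x : integralClosure A M) :
      inclusion A M N (AlgEquiv.restrictNormalHom M σ • x) = σ • inclusion A M N x :=
    Subtype.ext (AlgEquiv.restrictNormal_commutes σ M (x : M))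
  have hbelow : idealBelow A M N (σ • P) = idealBelow A M N P := by
    have hτ' : AlgEquiv.restrictNormalHom M σ • idealBelow A M N P = idealBelow A M N P := hτ
    ext x
    obtain ⟨y, rfl⟩ := MulAction.surjective (AlgEquiv.restrictNormalHom M σ) x
    conv_rhs => rw [← hτ', Ideal.smul_mem_pointwise_smul_iff]
    rw [idealBelow, Ideal.mem_comap, hcomm, Ideal.smul_mem_pointwise_smul_iff]
    rfl
  obtain ⟨ρ, hρ⟩ := exists_smul_eq_of_idealBelow_eq A M N (σ • P) P hbelow
  -- The corrected lift: ρ undoes the displacement of `P` and fixes `M` pointwise.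
  have hmem : ρ.restrictScalars K * σ ∈ decompositionGroup A K N P := by
    rw [MulAction.mem_stabilizer_iff, mul_smul]
    exact hρ.symm
  refine ⟨⟨_, hmem⟩, Subtype.ext ?_⟩
  change AlgEquiv.restrictNormalHom M (ρ.restrictScalars K * σ) = AlgEquiv.restrictNormalHom M σ
  ext x
  apply (algebraMap M N).injective
  change algebraMap M N ((ρ.restrictScalars K * σ).restrictNormal M x) =
    algebraMap M N (σ.restrictNormal M x)
  rw [AlgEquiv.restrictNormal_commutes, AlgEquiv.mul_apply,
    ← AlgEquiv.restrictNormal_commutes σ M x]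
  exact ρ.commutes _

variable {K}

/-- The orbits of the decomposition group on the roots are seen modulo separating invariant ideals
of any equivariant extension of the integral closure. -/
lemma orbitsSeenModuloIdeals (f : K[X]) [Fact (Irreducible f)] [f.IsSplittingField K M]
    [Normal K M] (hf : ∀ x : N, Polynomial.aeval x f = 0 → IsIntegral A x)
    (P : Ideal (integralClosure A N)) (R : Type*) [CommRing R] [Algebra (integralClosure A N) R]
    [MulSemiringAction (decompositionGroup A K N P) R]
    (hR : Function.Injective (algebraMap (integralClosure A N) R))
    (hsmul : ∀ (σ : decompositionGroup A K N P) (x : integralClosure A N),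
      σ • algebraMap (integralClosure A N) R x =
        algebraMap (integralClosure A N) R ((σ : Gal(N/K)) • x)) :
    OrbitsSeenModuloIdeals A M N f P R := by
  intro I hI hsep
  let φ : integralRoots A f N ≃ rootImages A N f I :=
    Equiv.ofBijective (reduceRoot A N f I) (reduceRoot_bijective A N f hR hsep)
  let action : MulAction (decompositionGroup A K M (idealBelow A M N P)) (rootImages A N f I) :=
    φ.symm.mulAction _
  have hφ (d : decompositionGroup A K M (idealBelow A M N P)) (v : integralRoots A f N) :
      φ (d • v) = d • φ v := by
    change φ (d • v) = φ (d • φ.symm (φ v))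
    rw [φ.symm_apply_apply]
  refine ⟨action, fun σ x => ?_, ?_, matchesOrbits_of_equiv φ hφ⟩
  · obtain ⟨v, rfl⟩ := φ.surjective x
    rw [← hφ]
    -- On the reduction of a root `v`, both actions are computed on `v` before reducing modulo `I`.
    change Ideal.Quotient.mk I (algebraMap (integralClosure A N) R
      ((AlgEquiv.restrictNormalHom M (σ : Gal(N/K)) • v : integralRoots A f N) :
        integralClosure A N)) =
      Ideal.Quotient.mk I (σ • algebraMap (integralClosure A N) R v)
    rw [restrictNormalHom_smul_root, hsmul]
  · have := galoisActionOnRootsOfSplits_faithful A M N f hf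
    have : FaithfulSMul (decompositionGroup A K M (idealBelow A M N P)) (rootImages A N f I) :=
      ⟨fun {d d'} h => FaithfulSMul.eq_of_smul_eq_smul (α := integralRoots A f N) fun v =>
        φ.injective (by rw [hφ, hφ, h])⟩
    exact orbitFactorization_injective

end Decomposition

end GaloisApproximation

theorem mainTheorem6
    (A K M N : Type*) [CommRing A] [IsDomain A] [IsLocalRing A] [IsNoetherianRing A]
    [IsIntegrallyClosed A] [Field K] [Algebra A K] [IsFractionRing A K]
    [Field M] [Field N] [Algebra K M] [Algebra K N] [Algebra M N] [Algebra A M] [Algebra A N]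
    [IsScalarTower A K M] [IsScalarTower A K N] [IsScalarTower K M N] [IsScalarTower A M N]
    (f : K[X]) [Fact (Irreducible f)] [f.IsSplittingField K M] [IsGalois K M]
    [FiniteDimensional K N] [IsGalois K N]
    (hf : ∀ x : N, Polynomial.aeval x f = 0 → IsIntegral A x)
    (P : Ideal (integralClosure A N)) [P.IsPrime] [P.LiesOver (IsLocalRing.maximalIdeal A)] :
    Function.Surjective (GaloisApproximation.restrictDecomposition A K M N P) ∧
      GaloisApproximation.OrbitsSeenModuloIdeals A M N f P (Localization.AtPrime P) ∧
      GaloisApproximation.OrbitsSeenModuloIdeals A M N f P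
        (AdicCompletion (IsLocalRing.maximalIdeal (Localization.AtPrime P))
          (Localization.AtPrime P)) := by
  -- Finiteness of the integral closure in a finite separable extension makes `C`, hence its
  -- localization, Noetherian. The localization is then separated in its maximal-adic topology
  -- (Krull), so it embeds in its completion.
  have : IsNoetherianRing (integralClosure A N) :=
    IsIntegralClosure.isNoetherianRing A K N (integralClosure A N)
  have : IsNoetherianRing (Localization.AtPrime P) :=
    IsLocalization.isNoetherianRing P.primeCompl _ inferInstance
  have hloc : Function.Injective
      (algebraMap (integralClosure A N) (Localization.AtPrime P)) :=
    IsLocalization.injective _ P.primeCompl_le_nonZeroDivisors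
  have hcompl : Function.Injective (algebraMap (Localization.AtPrime P)
      (AdicCompletion (IsLocalRing.maximalIdeal (Localization.AtPrime P))
        (Localization.AtPrime P))) :=
    AdicCompletion.of_injective _ _
  refine ⟨GaloisApproximation.restrictDecomposition_surjective A K M N P,
    GaloisApproximation.orbitsSeenModuloIdeals A M N f hf P _ hloc
      (GaloisApproximation.localizationAction_algebraMap P),
    GaloisApproximation.orbitsSeenModuloIdeals A M N f hf P _ (hcompl.comp hloc)
      fun σ x => ?_⟩
  refine (GaloisApproximation.completionAction_algebraMap σ
    (algebraMap (integralClosure A N) (Localization.AtPrime P) x)).trans ?_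
  rw [GaloisApproximation.localizationAction_algebraMap]
  rfl
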